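/- **Theorem 3 ($F$-PCSA).** Let $F$ be a finite field. For $z\in\mathbb{R}$, $r\in[0,1]$, $t\in(0,1)$ put $$\nu(z,r)=(1-e^{-2^{-z}})\,r\prod_{j=1}^{\infty}\bigl(1-(1-e^{-2^{-z-j}})r\bigr),\qquad \phi(t,r)=\int_{-\infty}^{\infty}2^{tz}\nu(z,r)\,dz .$$ Write $r_F=1-|F|^{-1}$. *The sketch.* Let $m\ge 3$ and $n\ge 0$. A subsketch over the universe $U=\{1,\dots,n\}$ has a random offset $\Theta$, uniform on $[0,1)$, and two tables $(H_{v,i})$, $(G_{v,i})$, $v\in U$, $i\in\mathbb{Z}$, with entries in $F$; given $\Theta$, all the entries of the two tables are independent, $H_{v,i}\in\{0,1\}$ with $\mathbb{P}(H_{v,i}=0\mid\Theta)=e^{-m^{-1}2^{-i-\Theta}}$, and $G_{v,i}$ is uniform on $F$. (This is the model under the random-oracle, poissonization and random-offset assumptions.) The stream state $x\in F^n$ and the memory state $s\in F^{\mathbb{Z}}$ start at zero, and an update $(v,k)\in U\times F$ does $x_v\gets x_v+k$ and $s_i\gets s_i+k\,H_{v,i}G_{v,i}$ for every $i\in\mathbb{Z}$.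 The highest position of the subsketch is $W=\sup\{i\in\mathbb{Z}: s_i\ne0\}+\Theta$ (with $\sup\emptyset=-\infty$ and $2^{-\infty}=0$). Let $W_1,\dots,W_m$ be the highest positions of $m$ i.i.d. subsketches that have processed the same fixed finite stream, with final stream state $x$, and let $\|x\|_0=|\{v\in U:x_v\neq0\}|$. Define $$\widehat{\|x\|_0}=\phi(1/m,r_F)^{-m}\,m\,2^{\frac1m\sum_{i=1}^m W_i}.$$ *Claim.* The integrals $\phi(t,r_F)$, $t\in(0,1)$, converge, $\nu(\cdot,r_F)$ is a probability density with a finite second moment, and if $\psi_{\mathbb E}(|F|)$ and $\psi_{\mathbb V}(|F|)$ denote the mean and the variance of a random variable with this density, then: 1. for every $m\ge3$, every $n$ and every stream, the estimator is square integrable and $$\mathbb{E}\,\widehat{\|x\|_0}=\|x\|_0,\qquad \mathbb{V}\,\widehat{\|x\|_0}=\bigl(\phi(1/m,r_F)^{-2m}\phi(2/m,r_F)^{m}-1\bigr)\|x\|_0^2;$$ 2. as $m\to\infty$, with error terms that depend only on $F$ and $m$ (not on $n$, the stream or the probability space), $$\phi(1/m,r_F)^{-m}=2^{-\psi_{\mathbb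 E}(|F|)}+O(m^{-1}),\qquad \widehat{\|x\|_0}=\bigl(2^{-\psi_{\mathbb E}(|F|)}+O(m^{-1})\bigr)\,m\,2^{\frac1m\sum_{i=1}^m W_i},$$ $$\mathbb{V}\,\widehat{\|x\|_0}=\|x\|_0^2\,m^{-1}\bigl((\log^2 2)\,\psi_{\mathbb V}(|F|)+O(m^{-1})\bigr),$$ where $\log$ is the natural logarithm and $\log^2 2=(\log 2)^2$; 3. $\sqrt{(\log^2 2)\,\psi_{\mathbb V}(|F|)}<\sqrt{79}$. -/

import Mathlib

open MeasureTheory ProbabilityTheory Asymptotics Filter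
open scoped ENNReal

namespace FPCSA

noncomputable section

/-! ### The stream and the memory of one subsketch -/

/-- The stream state: it starts at zero, and an update `(v, k)` adds `k` to coordinate `v`. -/
def streamState {F : Type*} [Field F] {n : ℕ} (σ : List (Fin n × F)) : Fin n → F :=
  σ.foldl (fun x u => Function.update x u.1 (x u.1 + u.2)) 0

/-- The memory state of one subsketch with tables `h` and `g`: it starts at zero, and an update
`(v, k)` adds `k * (h v i * g v i)` to cell `i`, for every `i : ℤ`. -/
def memoryState {F : Type*} [Field F] {n : ℕ} (h g : Fin n → ℤ → F) (σ : List (Fin n × F)) :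
    ℤ → F :=
  σ.foldl (fun s u => fun i => s i + u.2 * (h u.1 i * g u.1 i)) 0

/-- The highest index `sup {i | s i ≠ 0}`, with value `-∞` when all cells are zero. -/
def highestIndex {F : Type*} [Field F] (s : ℤ → F) : EReal :=
  ⨆ i ∈ {i : ℤ | s i ≠ 0}, ((i : ℝ) : EReal)

/-- The highest position: the highest index plus the offset. -/
def highestPosition {F : Type*} [Field F] (s : ℤ → F) (θ : ℝ) : EReal :=
  highestIndex s + (θ : EReal)

/-! ### The randomness of the sketch -/

/-- The probability `exp (-m⁻¹ 2^(-i-θ))` that a table entry in column `i` is not hit. -/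
def missProb (m : ℕ) (i : ℤ) (θ : ℝ) : ℝ :=
  Real.exp (-((m : ℝ)⁻¹ * (2 : ℝ) ^ (-(i : ℝ) - θ)))

/-- The law of `H v i` given the offset `θ`: `0` with probability `missProb m i θ`, else `1`. -/
def hitLaw (F : Type*) [Field F] [MeasurableSpace F] (m : ℕ) (i : ℤ) (θ : ℝ) : Measure F :=
  ENNReal.ofReal (missProb m i θ) • Measure.dirac 0 +
    ENNReal.ofReal (1 - missProb m i θ) • Measure.dirac 1

lemma missProb_le_one (m : ℕ) (i : ℤ) (θ : ℝ) : missProb m i θ ≤ 1 := by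
  unfold missProb
  rw [Real.exp_le_one_iff, neg_nonpos]
  positivity

instance (F : Type*) [Field F] [MeasurableSpace F] (m : ℕ) (i : ℤ) (θ : ℝ) :
    IsProbabilityMeasure (hitLaw F m i θ) where
  measure_univ := by
    have h1 : 0 ≤ missProb m i θ := (Real.exp_pos _).le
    have h2 : 0 ≤ 1 - missProb m i θ := sub_nonneg.2 (missProb_le_one m i θ)
    simp [hitLaw, ← ENNReal.ofReal_add h1 h2]

/-- The law of the pair `(H v i, G v i)` given the offset `θ`: the two entries are independent and
`G v i` is uniform on `F`. -/
def entryLaw (F : Type*) [Field F] [Fintype F] [MeasurableSpace F] (m : ℕ) (i : ℤ) (θ : ℝ) :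
    Measure (F × F) :=
  (hitLaw F m i θ).prod (PMF.uniformOfFintype F).toMeasure

instance (F : Type*) [Field F] [Fintype F] [MeasurableSpace F] (m : ℕ) (i : ℤ) (θ : ℝ) :
    IsProbabilityMeasure (entryLaw F m i θ) := by
  unfold entryLaw; infer_instance

lemma measurable_entryLaw (F : Type*) [Field F] [Fintype F] [MeasurableSpace F] (m : ℕ) (i : ℤ)
    {s : Set (F × F)} (hs : MeasurableSet s) : Measurable fun θ => entryLaw F m i θ s := by
  have h0 : Measurable fun θ : ℝ => missProb m i θ := by
    unfold missProb
    fun_prop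
  have h1 : Measurable fun θ : ℝ => hitLaw F m i θ := by
    refine Measure.measurable_of_measurable_coe _ fun t _ => ?_
    simp only [hitLaw, Measure.coe_add, Measure.coe_smul, Pi.add_apply, Pi.smul_apply,
      smul_eq_mul]
    fun_prop
  simp only [entryLaw, Measure.prod_apply hs]
  exact (Measure.measurable_lintegral (measurable_measure_prodMk_left hs)).comp h1

/-- The conditional law of the tables `(H v i, G v i)` given the offset: all entries are
independent. -/
def tableKernel (F : Type*) [Field F] [Fintype F] [MeasurableSpace F] (m n : ℕ) :
    Kernel ℝ (Fin n × ℤ → F × F) where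
  toFun θ := Measure.infinitePi fun p : Fin n × ℤ => entryLaw F m p.2 θ
  measurable' := by
    refine Measurable.measure_of_isPiSystem_of_isProbabilityMeasure
      (generateFrom_squareCylinders (ι := Fin n × ℤ) (α := fun _ => F × F)).symm
      (isPiSystem_squareCylinders (fun _ => MeasurableSpace.isPiSystem_measurableSet)
        (by simp)) ?_
    rintro _ ⟨s, t, ht, rfl⟩
    have ht' : ∀ p, MeasurableSet (t p) := fun p => ht p (Set.mem_univ p)
    have h : ∀ θ : ℝ, Measure.infinitePi (fun p : Fin n × ℤ => entryLaw F m p.2 θ)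
        ((s : Set (Fin n × ℤ)).pi t) = ∏ p ∈ s, entryLaw F m p.2 θ (t p) :=
      fun θ => Measure.infinitePi_pi _ fun p _ => ht' p
    simp only [h]
    exact Finset.measurable_prod s fun p _ => measurable_entryLaw F m p.2 (ht' p)

instance (F : Type*) [Field F] [Fintype F] [MeasurableSpace F] (m n : ℕ) :
    IsMarkovKernel (tableKernel F m n) where
  isProbabilityMeasure θ :=
    inferInstanceAs (IsProbabilityMeasure (Measure.infinitePi fun p : Fin n × ℤ =>
      entryLaw F m p.2 θ))

/-- The joint law of the offset and the tables of one subsketch: the offset is uniform on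
`[0, 1)`, and given the offset the tables have law `tableKernel`. -/
def subsketchLaw (F : Type*) [Field F] [Fintype F] [MeasurableSpace F] (m n : ℕ) :
    Measure (ℝ × (Fin n × ℤ → F × F)) :=
  (volume.restrict (Set.Ico (0 : ℝ) 1)) ⊗ₘ tableKernel F m n

/-- `Θ k`, `H k`, `G k` (for `k : Fin m`) are the offsets and the tables of `m` i.i.d. subsketches
over a universe of size `n`, under the random-oracle, poissonization and random-offset
assumptions. -/
structure IsSketchRandomness {F : Type*} [Field F] [Fintype F] [MeasurableSpace F] {m n : ℕ}
    {Ω : Type*} [MeasurableSpace Ω] (P : Measure Ω) (Θ : Fin m → Ω → ℝ)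
    (H G : Fin m → Fin n → ℤ → Ω → F) : Prop where
  hasLaw : ∀ k, HasLaw (fun ω => (Θ k ω, fun p : Fin n × ℤ => (H k p.1 p.2 ω, G k p.1 p.2 ω)))
    (subsketchLaw F m n) P
  indep : iIndepFun
    (fun k ω => (Θ k ω, fun p : Fin n × ℤ => (H k p.1 p.2 ω, G k p.1 p.2 ω))) P

/-- The highest position of subsketch `k` after the stream `σ` has been processed. -/
def position {F : Type*} [Field F] {m n : ℕ} {Ω : Type*} (Θ : Fin m → Ω → ℝ)
    (H G : Fin m → Fin n → ℤ → Ω → F) (σ : List (Fin n × F)) (k : Fin m) (ω : Ω) : EReal :=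
  highestPosition (memoryState (fun v i => H k v i ω) (fun v i => G k v i ω) σ) (Θ k ω)

/-! ### The density, its transform and its moments -/

/-- `ν(z, r) = (1 - e^(-2^(-z))) r ∏_{j ≥ 1} (1 - (1 - e^(-2^(-z-j))) r)`. -/
def nu (z r : ℝ) : ℝ :=
  (1 - Real.exp (-(2 : ℝ) ^ (-z))) * r *
    ∏' j : ℕ, (1 - (1 - Real.exp (-(2 : ℝ) ^ (-z - ((j : ℝ) + 1)))) * r)

/-- `φ(t, r) = ∫ 2^(tz) ν(z, r) dz`. -/
def phi (t r : ℝ) : ℝ := ∫ z : ℝ, (2 : ℝ) ^ (t * z) * nu z r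

/-- The law on the real line with density `ν(·, r)`. -/
def nuLaw (r : ℝ) : Measure ℝ := volume.withDensity fun z => ENNReal.ofReal (nu z r)

/-- The mean of the law with density `ν(·, 1 - q⁻¹)`. -/
def psiE (q : ℕ) : ℝ := ∫ z, z ∂(nuLaw (1 - (q : ℝ)⁻¹))

/-- The variance of the law with density `ν(·, 1 - q⁻¹)`. -/
def psiV (q : ℕ) : ℝ := variance (fun z : ℝ => z) (nuLaw (1 - (q : ℝ)⁻¹))

/-! ### The estimator -/

/-- `2^w` for an extended real `w`, with `2^(-∞) = 0`. -/
def twoPow (w : EReal) : ℝ := (EReal.exp ((Real.log 2 : ℝ) * w)).toReal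

/-- `2^((w₁ + ⋯ + w_m) / m)`. -/
def twoPowMean {m : ℕ} (w : Fin m → EReal) : ℝ :=
  twoPow ((((m : ℝ)⁻¹ : ℝ) : EReal) * ∑ k, w k)

/-- The estimator `φ(1/m, 1 - q⁻¹)^(-m) m 2^((w₁ + ⋯ + w_m) / m)` for a field of order `q`. -/
def estimator (q : ℕ) {m : ℕ} (w : Fin m → EReal) : ℝ :=
  phi (1 / (m : ℝ)) (1 - (q : ℝ)⁻¹) ^ (-(m : ℤ)) * (m : ℝ) * twoPowMean w

end

end FPCSA

/-!
The proof determines the law of the highest position `W` of one subsketch exactly. Cell `i` holds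
`∑ v, x v * H v i * G v i`. A hit coordinate with `x v ≠ 0` contributes a uniform element of `F`,
and one uniform summand makes the whole sum uniform, so with `N = ‖x‖₀` and `r = 1 - |F|⁻¹` the cell
is nonzero with probability `(1 - e^(-(N/m) 2^(-i-θ))) r`
(`IsZeroUniformMixture.sum`, `cellLaw_zero_eq_occupancy`). The cells are independent given the
offset `θ`, hence the highest nonzero index is `i` with probability `ν(i + θ - log₂ (N/m), r)`
(`lintegral_highestIndex`). These numbers sum to one, because `ν(z, r) = Q(z) - Q(z - 1)` telescopes,
where `Q(z)` is the probability `zeroAbove z r` that everything above `z` is zero, with limits `1`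
and `0` at `±∞`. Averaging over the uniform offset glues the lattices `θ + ℤ` to the real line: `W`
is distributed as `Z + log₂ (N/m)`, where `Z` has density `ν(·, r)`
(`map_cellsPosition_subsketchLaw`).

The estimator is a constant times `∏ 2^(W_k / m)` almost surely, so its moments are powers of
`E[2^(W/m)] = (N/m)^(1/m) φ(1/m)` and `E[2^(2W/m)] = (N/m)^(2/m) φ(2/m)`, which is finite since
`2/m < 1` (`estimator_moments`).

The density is at most `2^(-z)`, and at most `e^(1/3) e^(-|z|/3)`: going down one step below zero
multiplies `Q` by at most `e^(-1/3)`. Hence `φ(t, r)` is the moment generating function of `Z` at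
`t log 2`, the cumulant generating function is analytic at zero, and its second-order Taylor
expansion gives both asymptotic formulas (`mgf_zpow_neg_isBigO`, `mgf_zpow_neg_mul_pow_isBigO`). The
same bound gives `Var Z ≤ 1.4 * 108`, and `(log 2)² * 1.4 * 108 < 79`.
-/

namespace FPCSA

open Topology

/-! ### The density as a telescoping difference -/

/-- The probability that a Poisson number of hits with mean `2^(-z)` is positive. -/
noncomputable def occupancy (z : ℝ) : ℝ := 1 - Real.exp (-(2 : ℝ) ^ (-z))

/-- The probability that all cells strictly above position `z` are zero, when the cell at
position `z + j` is nonzero with probability `occupancy (z + j) * r`, independently. -/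
noncomputable def zeroAbove (z r : ℝ) : ℝ := ∏' j : ℕ, (1 - occupancy (z + ((j : ℝ) + 1)) * r)

lemma nu_eq_mul (z r : ℝ) : nu z r = occupancy z * r * zeroAbove z r := by
  simp only [nu, zeroAbove, occupancy, neg_add']

lemma occupancy_nonneg (z : ℝ) : 0 ≤ occupancy z := by
  have : Real.exp (-(2 : ℝ) ^ (-z)) ≤ 1 := Real.exp_le_one_iff.2 (by simp; positivity)
  unfold occupancy; linarith

lemma occupancy_le_two_rpow (z : ℝ) : occupancy z ≤ (2 : ℝ) ^ (-z) := by
  have := Real.add_one_le_exp (-(2 : ℝ) ^ (-z))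
  unfold occupancy; linarith

lemma occupancy_antitone : Antitone occupancy := by
  intro a b h
  unfold occupancy
  have : (2 : ℝ) ^ (-b) ≤ 2 ^ (-a) := Real.rpow_le_rpow_of_exponent_le one_le_two (by linarith)
  gcongr

lemma measurable_occupancy : Measurable occupancy := by
  unfold occupancy; fun_prop

section

variable {r : ℝ}

lemma exp_le_one_sub_occupancy_mul (h1 : r ≤ 1) (z : ℝ) :
    Real.exp (-(2 : ℝ) ^ (-z)) ≤ 1 - occupancy z * r := by
  have := mul_le_mul_of_nonneg_left h1 (occupancy_nonneg z)
  unfold occupancy at *; linarith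

lemma one_sub_occupancy_mul_pos (h1 : r ≤ 1) (z : ℝ) : 0 < 1 - occupancy z * r :=
  (Real.exp_pos _).trans_le (exp_le_one_sub_occupancy_mul h1 z)

lemma one_sub_occupancy_mul_le_one (h0 : 0 ≤ r) (z : ℝ) : 1 - occupancy z * r ≤ 1 := by
  have := mul_nonneg (occupancy_nonneg z) h0
  linarith

lemma hasSum_two_rpow (z : ℝ) :
    HasSum (fun j : ℕ => (2 : ℝ) ^ (-(z + ((j : ℝ) + 1)))) ((2 : ℝ) ^ (-z)) := by
  have h := (hasSum_geometric_two' (1 : ℝ)).mul_left ((2 : ℝ) ^ (-z))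
  rw [mul_one] at h
  refine h.congr_fun fun j => ?_
  rw [neg_add, Real.rpow_add two_pos, neg_add, Real.rpow_add two_pos,
    Real.rpow_neg two_pos.le (j : ℝ), Real.rpow_natCast, Real.rpow_neg_one]
  field_simp

lemma summable_occupancy (z : ℝ) : Summable fun j : ℕ => occupancy (z + ((j : ℝ) + 1)) :=
  .of_nonneg_of_le (fun _ => occupancy_nonneg _) (fun _ => occupancy_le_two_rpow _)
    (hasSum_two_rpow z).summable

lemma multipliable_zeroAbove (z r : ℝ) :
    Multipliable fun j : ℕ => 1 - occupancy (z + ((j : ℝ) + 1)) * r := by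
  simpa [sub_eq_add_neg] using
    Real.multipliable_one_add_of_summable ((summable_occupancy z).mul_right r).neg

lemma exp_le_zeroAbove (h1 : r ≤ 1) (z : ℝ) :
    Real.exp (-(2 : ℝ) ^ (-z)) ≤ zeroAbove z r := by
  have h := (hasSum_two_rpow z).neg.rexp
  refine le_of_tendsto_of_tendsto' h.tendsto_prod_nat
    (multipliable_zeroAbove z r).hasProd.tendsto_prod_nat fun n => ?_
  exact Finset.prod_le_prod (fun _ _ => (Real.exp_pos _).le)
    fun _ _ => exp_le_one_sub_occupancy_mul h1 _

lemma zeroAbove_nonneg (h1 : r ≤ 1) (z : ℝ) : 0 ≤ zeroAbove z r :=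
  (Real.exp_pos _).le.trans (exp_le_zeroAbove h1 z)

lemma zeroAbove_le_one (h0 : 0 ≤ r) (h1 : r ≤ 1) (z : ℝ) : zeroAbove z r ≤ 1 := by
  refine le_of_tendsto' (multipliable_zeroAbove z r).hasProd.tendsto_prod_nat fun n => ?_
  exact Finset.prod_le_one (fun _ _ => (one_sub_occupancy_mul_pos h1 _).le)
    fun _ _ => one_sub_occupancy_mul_le_one h0 _

lemma zeroAbove_sub_one (z r : ℝ) :
    zeroAbove (z - 1) r = (1 - occupancy z * r) * zeroAbove z r := by
  have e : ∀ j : ℕ, z - 1 + (((j + 1 : ℕ) : ℝ) + 1) = z + ((j : ℝ) + 1) := fun j => by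
    push_cast; ring
  unfold zeroAbove
  rw [tprod_eq_zero_mul']
  · simp only [e]; simp
  · simpa [e] using multipliable_zeroAbove z r

/-- The highest position is `z` when nothing above `z` is nonzero, but something above `z - 1`
is. -/
lemma nu_eq_sub (z r : ℝ) : nu z r = zeroAbove z r - zeroAbove (z - 1) r := by
  rw [nu_eq_mul, zeroAbove_sub_one]; ring

lemma nu_nonneg (h0 : 0 ≤ r) (h1 : r ≤ 1) (z : ℝ) : 0 ≤ nu z r := by
  rw [nu_eq_mul]
  exact mul_nonneg (mul_nonneg (occupancy_nonneg z) h0) (zeroAbove_nonneg h1 z)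

lemma nu_le_zeroAbove (h1 : r ≤ 1) (z : ℝ) : nu z r ≤ zeroAbove z r := by
  rw [nu_eq_sub]
  linarith [zeroAbove_nonneg h1 (z - 1)]

lemma nu_le_two_rpow (h0 : 0 ≤ r) (h1 : r ≤ 1) (z : ℝ) : nu z r ≤ (2 : ℝ) ^ (-z) := by
  rw [nu_eq_mul]
  calc occupancy z * r * zeroAbove z r ≤ (2 : ℝ) ^ (-z) * 1 * 1 := by
        have := occupancy_nonneg z
        have := zeroAbove_nonneg h1 z
        gcongr
        · exact occupancy_le_two_rpow z
        · exact zeroAbove_le_one h0 h1 z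
    _ = _ := by ring

lemma measurable_nu (r : ℝ) : Measurable fun z => nu z r := by
  have h : Measurable fun z => zeroAbove z r := by
    refine measurable_of_tendsto_metrizable (f := fun (n : ℕ) z =>
      ∏ j ∈ Finset.range n, (1 - occupancy (z + ((j : ℝ) + 1)) * r)) (fun n => ?_)
      (tendsto_pi_nhds.2 fun z => (multipliable_zeroAbove z r).hasProd.tendsto_prod_nat)
    have := measurable_occupancy
    fun_prop
  simp only [nu_eq_mul]
  exact (measurable_occupancy.mul_const r).mul h

/-! ### Tail bounds -/

/-- Below zero a cell is occupied with probability at least `1 - e⁻¹`, so it is zero with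
probability at most `(1 + e⁻¹) / 2 < 0.7 < e^(-1/3)`. -/
lemma one_sub_occupancy_mul_le (h : 1 / 2 ≤ r) {z : ℝ} (hz : z ≤ 0) :
    1 - occupancy z * r ≤ Real.exp (-(1 / 3)) := by
  have h1 : 1 - Real.exp (-1) ≤ occupancy z := by
    simpa [occupancy] using occupancy_antitone hz
  have h2 : Real.exp (-1) = Real.exp (-(1 / 3)) ^ 3 := by
    rw [← Real.exp_nat_mul]; norm_num
  have h3 : 0.36 < Real.exp (-1) ∧ Real.exp (-1) < 0.37 :=
    ⟨by linarith [Real.exp_neg_one_gt_d9], by linarith [Real.exp_neg_one_lt_d9]⟩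
  have h4 : 0.7 ≤ Real.exp (-(1 / 3)) := by
    by_contra! h
    have : Real.exp (-(1 / 3)) ^ 3 < 0.7 ^ 3 := by gcongr
    norm_num at this
    linarith [h3.1]
  nlinarith [h3.2]

lemma zeroAbove_sub_nat_le (h : 1 / 2 ≤ r) (h1 : r ≤ 1) {z : ℝ} (hz : z ≤ 0) (n : ℕ) :
    zeroAbove (z - n) r ≤ Real.exp (-(1 / 3)) ^ n := by
  induction n with
  | zero => simpa using zeroAbove_le_one (by linarith) h1 z
  | succ n ih =>
    rw [Nat.cast_succ, ← sub_sub, zeroAbove_sub_one, pow_succ']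
    have hn : z - n ≤ 0 := by linarith [n.cast_nonneg (α := ℝ)]
    exact mul_le_mul (one_sub_occupancy_mul_le h hn) ih (zeroAbove_nonneg h1 _)
      (Real.exp_pos _).le

/-- At each step below zero the probability of seeing only zeros above shrinks at least by the
factor `e^(-1/3)`. -/
lemma zeroAbove_le_exp (h : 1 / 2 ≤ r) (h1 : r ≤ 1) {z : ℝ} (hz : z ≤ 0) :
    zeroAbove z r ≤ Real.exp (1 / 3) * Real.exp (z / 3) := by
  have hf : (⌊-z⌋₊ : ℝ) ≤ -z := Nat.floor_le (by linarith)
  have hl : -z < ⌊-z⌋₊ + 1 := Nat.lt_floor_add_one (-z)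
  have := zeroAbove_sub_nat_le h h1 (z := z + ⌊-z⌋₊) (by linarith) ⌊-z⌋₊
  rw [add_sub_cancel_right, ← Real.exp_nat_mul] at this
  refine this.trans ?_
  rw [← Real.exp_add]
  gcongr
  linarith

lemma two_rpow_neg_le_exp {z : ℝ} (hz : 0 ≤ z) : (2 : ℝ) ^ (-z) ≤ Real.exp (-z / 3) := by
  rw [Real.rpow_def_of_pos two_pos]
  gcongr
  nlinarith [Real.log_two_gt_d9]

lemma nu_le_exp_abs (h : 1 / 2 ≤ r) (h1 : r ≤ 1) (z : ℝ) :
    nu z r ≤ Real.exp (1 / 3) * Real.exp (-(1 / 3 * |z|)) := by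
  have h0 : 0 ≤ r := by linarith
  rcases le_total z 0 with hz | hz
  · refine (nu_le_zeroAbove h1 z).trans ((zeroAbove_le_exp h h1 hz).trans_eq ?_)
    rw [abs_of_nonpos hz]; congr 2; ring
  · refine (nu_le_two_rpow h0 h1 z).trans ((two_rpow_neg_le_exp hz).trans ?_)
    rw [abs_of_nonneg hz, ← Real.exp_add]
    gcongr
    linarith

/-! ### The total mass of the density -/

lemma tendsto_zeroAbove_add_nat (h0 : 0 ≤ r) (h1 : r ≤ 1) (z : ℝ) :
    Tendsto (fun n : ℕ => zeroAbove (z + n) r) atTop (𝓝 1) := by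
  refine tendsto_of_tendsto_of_tendsto_of_le_of_le ?_ tendsto_const_nhds
    (fun n => exp_le_zeroAbove h1 _) (fun n => zeroAbove_le_one h0 h1 _)
  have h2 : Tendsto (fun n : ℕ => (2 : ℝ) ^ (-(z + n))) atTop (𝓝 0) :=
    (tendsto_rpow_atBot_of_base_gt_one 2 one_lt_two).comp
      (tendsto_neg_atTop_atBot.comp (tendsto_atTop_add_const_left _ z tendsto_natCast_atTop_atTop))
  have h3 := (Real.continuous_exp.tendsto _).comp h2.neg
  rwa [neg_zero, Real.exp_zero] at h3

lemma tendsto_zeroAbove_sub_nat (h : 1 / 2 ≤ r) (h1 : r ≤ 1) (z : ℝ) :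
    Tendsto (fun n : ℕ => zeroAbove (z - n) r) atTop (𝓝 0) := by
  obtain ⟨k, hk⟩ := exists_nat_ge z
  rw [← tendsto_add_atTop_iff_nat k]
  refine squeeze_zero (fun n => zeroAbove_nonneg h1 _) (fun n => ?_)
    (tendsto_pow_atTop_nhds_zero_of_lt_one (Real.exp_pos (-(1 / 3))).le
      (Real.exp_lt_one_iff.2 (by norm_num)))
  have := zeroAbove_sub_nat_le h h1 (z := z - k) (by linarith) n
  rwa [sub_sub, add_comm, ← Nat.cast_add] at this

/-- On each lattice `z + ℤ` the density sums to one. -/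
lemma hasSum_nu_add_int (h : 1 / 2 ≤ r) (h1 : r ≤ 1) (z : ℝ) :
    HasSum (fun i : ℤ => nu (z + i) r) 1 := by
  have h0 : 0 ≤ r := by linarith
  have hp : HasSum (fun n : ℕ => nu (z + ((n : ℤ) : ℝ)) r) (1 - zeroAbove (z - 1) r) := by
    rw [hasSum_iff_tendsto_nat_of_nonneg (fun _ => nu_nonneg h0 h1 _)]
    have hs : ∀ n : ℕ, ∑ i ∈ Finset.range n, nu (z + ((i : ℤ) : ℝ)) r =
        zeroAbove (z - 1 + n) r - zeroAbove (z - 1) r := by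
      intro n
      have := Finset.sum_range_sub (fun n : ℕ => zeroAbove (z - 1 + n) r) n
      simp only [Nat.cast_zero, add_zero] at this
      rw [← this]
      refine Finset.sum_congr rfl fun i _ => ?_
      rw [nu_eq_sub]; push_cast; congr 2 <;> ring
    simp only [hs]
    exact (tendsto_zeroAbove_add_nat h0 h1 (z - 1)).sub_const _
  have hn : HasSum (fun n : ℕ => nu (z + ((-((n : ℤ) + 1) : ℤ) : ℝ)) r) (zeroAbove (z - 1) r) := by
    rw [hasSum_iff_tendsto_nat_of_nonneg (fun _ => nu_nonneg h0 h1 _)]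
    have hs : ∀ n : ℕ, ∑ i ∈ Finset.range n, nu (z + ((-((i : ℤ) + 1) : ℤ) : ℝ)) r =
        zeroAbove (z - 1) r - zeroAbove (z - 1 - n) r := by
      intro n
      have := Finset.sum_range_sub' (fun n : ℕ => zeroAbove (z - 1 - n) r) n
      simp only [Nat.cast_zero, sub_zero] at this
      rw [← this]
      refine Finset.sum_congr rfl fun i _ => ?_
      rw [nu_eq_sub]; push_cast; congr 2 <;> ring
    simp only [hs]
    simpa using (tendsto_zeroAbove_sub_nat h h1 (z - 1)).const_sub (zeroAbove (z - 1) r)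
  have := HasSum.of_nat_of_neg_add_one (f := fun i : ℤ => nu (z + (i : ℝ)) r) hp hn
  rwa [sub_add_cancel] at this

lemma tsum_ofReal_nu_add_int (h : 1 / 2 ≤ r) (h1 : r ≤ 1) (z : ℝ) :
    ∑' i : ℤ, ENNReal.ofReal (nu (z + i) r) = 1 := by
  have hs := hasSum_nu_add_int h h1 z
  rw [← ENNReal.ofReal_tsum_of_nonneg (fun i => nu_nonneg (by linarith) h1 _) hs.summable,
    hs.tsum_eq, ENNReal.ofReal_one]

end

/-- Folding an integral over the line onto the unit interval. -/
lemma lintegral_eq_lintegral_Ico_tsum {f : ℝ → ℝ≥0∞} (hf : Measurable f) :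
    ∫⁻ z, f z = ∫⁻ θ in Set.Ico (0 : ℝ) 1, ∑' i : ℤ, f (θ + i) := by
  rw [lintegral_tsum (fun i => by fun_prop), ← setLIntegral_univ,
    ← iUnion_Ico_intCast ℝ, lintegral_iUnion (fun i => measurableSet_Ico)]
  · refine tsum_congr fun i => ?_
    have := (measurePreserving_add_right volume (i : ℝ)).setLIntegral_comp_preimage
      (measurableSet_Ico (a := (i : ℝ)) (b := i + 1)) hf
    rw [← this]
    congr 2
    ext x; simp
  · exact Set.pairwise_disjoint_Ico_intCast ℝ

lemma lintegral_nuLaw (r : ℝ) {f : ℝ → ℝ≥0∞} (hf : Measurable f) :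
    ∫⁻ z, f z ∂nuLaw r = ∫⁻ z, ENNReal.ofReal (nu z r) * f z := by
  rw [nuLaw, lintegral_withDensity_eq_lintegral_mul _ (measurable_nu r).ennreal_ofReal hf]
  rfl

lemma isProbabilityMeasure_nuLaw {r : ℝ} (h : 1 / 2 ≤ r) (h1 : r ≤ 1) :
    IsProbabilityMeasure (nuLaw r) where
  measure_univ := by
    have := measurable_nu r
    rw [nuLaw, withDensity_apply _ .univ, setLIntegral_univ,
      lintegral_eq_lintegral_Ico_tsum (by fun_prop)]
    simp [tsum_ofReal_nu_add_int h h1]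

/-! ### Exponential moments of the density -/

section

variable {r : ℝ}

lemma integrable_nuLaw_iff (h0 : 0 ≤ r) (h1 : r ≤ 1) {f : ℝ → ℝ} :
    Integrable f (nuLaw r) ↔ Integrable fun z => nu z r * f z := by
  rw [nuLaw, integrable_withDensity_iff_integrable_smul' (measurable_nu r).ennreal_ofReal
    (ae_of_all _ fun _ => ENNReal.ofReal_lt_top)]
  simp only [ENNReal.toReal_ofReal (nu_nonneg h0 h1 _), smul_eq_mul]

lemma integral_nuLaw (h0 : 0 ≤ r) (h1 : r ≤ 1) (f : ℝ → ℝ) :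
    ∫ z, f z ∂nuLaw r = ∫ z, nu z r * f z := by
  rw [nuLaw, integral_withDensity_eq_integral_toReal_smul (measurable_nu r).ennreal_ofReal
    (ae_of_all _ fun _ => ENNReal.ofReal_lt_top)]
  simp only [ENNReal.toReal_ofReal (nu_nonneg h0 h1 _), smul_eq_mul]

/-- The density decays at least like `e^(z/3)` at `-∞` and like `2^(-z)` at `∞`. -/
lemma integrable_nu_mul_exp (h : 1 / 2 ≤ r) (h1 : r ≤ 1) {s : ℝ} (hs : -(1 / 3) < s)
    (hs' : s < Real.log 2) : Integrable fun z => nu z r * Real.exp (s * z) := by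
  have h0 : 0 ≤ r := by linarith
  have hm : AEStronglyMeasurable (fun z => nu z r * Real.exp (s * z)) := by
    have := measurable_nu r
    fun_prop
  have hn : ∀ z, ‖nu z r * Real.exp (s * z)‖ = nu z r * Real.exp (s * z) := fun z => by
    rw [Real.norm_of_nonneg (mul_nonneg (nu_nonneg h0 h1 z) (Real.exp_pos _).le)]
  rw [← integrableOn_univ, ← Set.Iic_union_Ioi (a := (0 : ℝ))]
  refine IntegrableOn.union ?_ ?_
  · refine Integrable.mono'
      ((integrableOn_exp_mul_Iic (a := 1 / 3 + s) (by linarith) 0).const_mul (Real.exp (1 / 3)))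
      hm.restrict ((ae_restrict_iff' measurableSet_Iic).2 (ae_of_all _ fun z hz => ?_))
    rw [hn, add_mul, Real.exp_add, ← mul_assoc]
    have := (nu_le_zeroAbove h1 z).trans (zeroAbove_le_exp h h1 hz)
    rw [div_eq_inv_mul z, ← one_div] at this
    gcongr
  · refine Integrable.mono' (integrableOn_exp_mul_Ioi (a := s - Real.log 2) (by linarith) 0)
      hm.restrict ((ae_restrict_iff' measurableSet_Ioi).2 (ae_of_all _ fun z hz => ?_))
    rw [hn, sub_mul, sub_eq_neg_add, Real.exp_add]
    have := nu_le_two_rpow h0 h1 z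
    rw [Real.rpow_def_of_pos two_pos, mul_neg] at this
    gcongr

lemma zero_mem_interior_integrableExpSet (h : 1 / 2 ≤ r) (h1 : r ≤ 1) :
    0 ∈ interior (integrableExpSet (fun z : ℝ => z) (nuLaw r)) := by
  rw [mem_interior]
  refine ⟨Set.Ioo (-(1 / 3)) (Real.log 2), fun s hs => ?_, isOpen_Ioo,
    by norm_num, Real.log_pos one_lt_two⟩
  exact (integrable_nuLaw_iff (by linarith) h1).2 (integrable_nu_mul_exp h h1 hs.1 hs.2)

lemma two_rpow_mul_nu (t z r : ℝ) :
    (2 : ℝ) ^ (t * z) * nu z r = nu z r * Real.exp (t * Real.log 2 * z) := by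
  rw [Real.rpow_def_of_pos two_pos, mul_comm]; congr 2; ring

lemma integrable_two_rpow_mul_nu (h : 1 / 2 ≤ r) (h1 : r ≤ 1) {t : ℝ} (ht : 0 ≤ t)
    (ht1 : t < 1) : Integrable fun z => (2 : ℝ) ^ (t * z) * nu z r := by
  simp only [two_rpow_mul_nu]
  have hl : 0 < Real.log 2 := Real.log_pos one_lt_two
  have : 0 ≤ t * Real.log 2 := by positivity
  exact integrable_nu_mul_exp h h1 (by linarith) (by nlinarith)

lemma phi_eq_mgf (h0 : 0 ≤ r) (h1 : r ≤ 1) (t : ℝ) :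
    phi t r = mgf (fun z : ℝ => z) (nuLaw r) (t * Real.log 2) := by
  simp only [phi, mgf, two_rpow_mul_nu, integral_nuLaw h0 h1]

lemma phi_pos (h : 1 / 2 ≤ r) (h1 : r ≤ 1) {t : ℝ} (ht : 0 ≤ t) (ht1 : t < 1) :
    0 < phi t r := by
  have h0 : 0 ≤ r := by linarith
  have := isProbabilityMeasure_nuLaw h h1
  rw [phi_eq_mgf h0 h1]
  refine mgf_pos ((integrable_nuLaw_iff h0 h1).2 ?_)
  simpa only [two_rpow_mul_nu] using integrable_two_rpow_mul_nu h h1 ht ht1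

lemma integral_exp_neg_abs_mul_sq :
    ∫ z : ℝ, Real.exp (-(1 / 3 * |z|)) * z ^ 2 = 108 := by
  have h := integral_comp_abs (f := fun z : ℝ => Real.exp (-(1 / 3 * z)) * z ^ 2)
  simp only [sq_abs] at h
  have h2 := Real.integral_rpow_mul_exp_neg_mul_Ioi (a := 3) (r := 1 / 3) (by norm_num)
    (by norm_num)
  have h3 : Real.Gamma 3 = 2 := by
    have := Real.Gamma_nat_eq_factorial 2
    rw [Nat.factorial_two, Nat.cast_ofNat] at this
    rw [← this]; norm_num
  rw [h3] at h2
  norm_num at h2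
  rw [h]
  simp only [mul_comm (Real.exp _)]
  norm_num
  rw [h2]; norm_num

/-- The variance is at most the second moment, and the density is at most
`e^(1/3) e^(-|z|/3)` with `e^(1/3) ≤ 1.4`. -/
lemma variance_nuLaw_le (h : 1 / 2 ≤ r) (h1 : r ≤ 1) :
    variance (fun z : ℝ => z) (nuLaw r) ≤ 1.4 * 108 := by
  have h0 : 0 ≤ r := by linarith
  have := isProbabilityMeasure_nuLaw h h1
  refine (variance_le_expectation_sq measurable_id.aestronglyMeasurable).trans ?_
  have he : Real.exp (1 / 3) ≤ 1.4 := by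
    have h2 : Real.exp (1 / 3) ^ 3 = Real.exp 1 := by rw [← Real.exp_nat_mul]; norm_num
    by_contra! h
    have : 1.4 ^ 3 < Real.exp (1 / 3) ^ 3 := by gcongr
    norm_num at this h2
    linarith [Real.exp_one_lt_d9]
  have hi := integral_exp_neg_abs_mul_sq
  calc ∫ z, ((fun z : ℝ => z) ^ 2) z ∂nuLaw r
      = ∫ z, nu z r * z ^ 2 := integral_nuLaw h0 h1 _
    _ ≤ ∫ z, Real.exp (1 / 3) * (Real.exp (-(1 / 3 * |z|)) * z ^ 2) := by
        refine integral_mono_of_nonneg (ae_of_all _ fun z => ?_) ?_ (ae_of_all _ fun z => ?_)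
        · exact mul_nonneg (nu_nonneg h0 h1 z) (sq_nonneg z)
        -- A function with nonzero Bochner integral is integrable.
        · exact (Integrable.of_integral_ne_zero (by rw [hi]; norm_num)).const_mul _
        · have := nu_le_exp_abs h h1 z
          simp only [← mul_assoc]
          gcongr
    _ ≤ 1.4 * 108 := by
        rw [integral_const_mul, hi]
        gcongr

end

/-! ### Second-order expansion of powers of a moment generating function -/

section

variable {Ω : Type*} {mΩ : MeasurableSpace Ω} {X : Ω → ℝ} {μ : Measure Ω}

/-- The cumulant generating function is analytic at zero, with the mean and the variance as its
first two derivatives there. -/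
lemma cgf_sub_isBigO [IsProbabilityMeasure μ] (h : 0 ∈ interior (integrableExpSet X μ)) :
    (fun s => cgf X μ s - (s * μ[X] + s ^ 2 * Var[X; μ] / 2)) =O[𝓝 0] fun s => s ^ 3 := by
  have hv : iteratedDeriv 2 (cgf X μ) 0 = Var[X; μ] := by
    rw [iteratedDeriv_two_cgf_eq_integral h, deriv_cgf_zero h,
      variance_eq_integral (memLp_of_mem_interior_integrableExpSet h 1).aemeasurable]
    simp
  have hp := (analyticAt_cgf h).hasFPowerSeriesAt.isBigO_sub_partialSum_pow 3
  refine IsBigO.congr (hp.trans (IsBigO.of_norm_right ?_)) (fun s => ?_) fun s => rfl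
  · simpa using isBigO_refl (fun s : ℝ => |s| ^ 3) (𝓝 0)
  · simp [FormalMultilinearSeries.partialSum, Finset.sum_range_succ,
      deriv_cgf_zero h, hv]
    ring

lemma tendsto_div_natCast (c : ℝ) : Tendsto (fun m : ℕ => c / (m : ℝ)) atTop (𝓝 0) :=
  tendsto_const_nhds.div_atTop tendsto_natCast_atTop_atTop

lemma natCast_mul_cgf_isBigO [IsProbabilityMeasure μ] (h : 0 ∈ interior (integrableExpSet X μ))
    (c : ℝ) :
    (fun m : ℕ => (m : ℝ) * cgf X μ (c / m) - (c * μ[X] + c ^ 2 * Var[X; μ] / 2 / m))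
      =O[atTop] fun m : ℕ => (1 / (m : ℝ)) ^ 2 := by
  have h1 := (cgf_sub_isBigO h).comp_tendsto (tendsto_div_natCast c)
  have h2 := (isBigO_refl (fun m : ℕ => (m : ℝ)) atTop).mul h1
  refine (h2.trans ?_).congr' ?_ EventuallyEq.rfl
  · refine IsBigO.of_bound (|c| ^ 3) ?_
    filter_upwards [eventually_gt_atTop 0] with m hm
    have : (0 : ℝ) < m := by exact_mod_cast hm
    simp only [Function.comp_apply, norm_mul, norm_pow, norm_div, norm_one,
      Real.norm_eq_abs]
    apply le_of_eq
    field_simp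
  · filter_upwards [eventually_gt_atTop 0] with m hm
    have : (0 : ℝ) < m := by exact_mod_cast hm
    simp only [Function.comp_apply]
    field_simp

lemma one_div_sq_isBigO : (fun m : ℕ => (1 / (m : ℝ)) ^ 2) =O[atTop] fun m : ℕ => 1 / (m : ℝ) := by
  refine IsBigO.of_bound 1 ?_
  filter_upwards [eventually_gt_atTop 0] with m hm
  have : (1 : ℝ) ≤ m := by exact_mod_cast hm
  rw [one_mul, norm_pow]
  refine pow_le_of_le_one (norm_nonneg _) ?_ two_ne_zero
  rw [Real.norm_of_nonneg (by positivity)]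
  exact (div_le_one (by linarith)).2 this

lemma eventually_mgf_eq_exp_cgf [IsProbabilityMeasure μ]
    (h : 0 ∈ interior (integrableExpSet X μ)) (c : ℝ) :
    ∀ᶠ m : ℕ in atTop, mgf X μ (c / m) = Real.exp (cgf X μ (c / m)) := by
  filter_upwards [(tendsto_div_natCast c).eventually (mem_interior_iff_mem_nhds.1 h)] with m hm
  exact (exp_cgf hm).symm

/-- With `K` the cumulant generating function, `M(c/m)^(-m) = exp (-m K(c/m))`, where
`m K(c/m) = c E[X] + O(1/m)`. -/
lemma mgf_zpow_neg_isBigO [IsProbabilityMeasure μ] (h : 0 ∈ interior (integrableExpSet X μ))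
    (c : ℝ) :
    (fun m : ℕ => mgf X μ (c / m) ^ (-(m : ℤ)) - Real.exp (-(c * μ[X])))
      =O[atTop] fun m : ℕ => 1 / (m : ℝ) := by
  set u : ℕ → ℝ := fun m => c * μ[X] - m * cgf X μ (c / m) with hu
  have hu1 : u =O[atTop] fun m : ℕ => 1 / (m : ℝ) := by
    have h1 := (natCast_mul_cgf_isBigO h c).trans one_div_sq_isBigO
    have h2 : (fun m : ℕ => c ^ 2 * Var[X; μ] / 2 / m) =O[atTop] fun m : ℕ => 1 / (m : ℝ) := by
      simpa [div_eq_mul_inv] using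
        (isBigO_refl (fun m : ℕ => (m : ℝ)⁻¹) atTop).const_mul_left (c ^ 2 * Var[X; μ] * 2⁻¹)
    refine (h1.add h2).neg_left.congr_left fun m => ?_
    simp only [hu]; ring
  have hu0 : Tendsto u atTop (𝓝 0) := hu1.trans_tendsto (tendsto_div_natCast 1)
  have he := ((Real.exp_sub_sum_range_isBigO_pow 1).comp_tendsto hu0)
  simp only [pow_one, Function.comp_def] at he
  refine ((he.trans hu1).const_mul_left (Real.exp (-(c * μ[X])))).congr' ?_ EventuallyEq.rfl
  filter_upwards [eventually_mgf_eq_exp_cgf h c] with m hm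
  rw [hm, zpow_neg, zpow_natCast, ← Real.exp_nat_mul, ← Real.exp_neg]
  simp only [Finset.sum_range_one, pow_zero, Nat.factorial_zero, Nat.cast_one, div_one, mul_sub,
    ← Real.exp_add, mul_one, hu]
  congr 2; ring

/-- With `K` the cumulant generating function, the power product is
`exp (m K(2c/m) - 2m K(c/m))`; the linear terms of `K` cancel, and the quadratic ones leave
`c² Var[X] / m`. -/
lemma mgf_zpow_neg_mul_pow_isBigO [IsProbabilityMeasure μ]
    (h : 0 ∈ interior (integrableExpSet X μ)) (c : ℝ) :
    (fun m : ℕ => (m : ℝ) * (mgf X μ (c / m) ^ (-(2 * (m : ℤ))) * mgf X μ (2 * c / m) ^ m - 1) -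
      c ^ 2 * Var[X; μ]) =O[atTop] fun m : ℕ => 1 / (m : ℝ) := by
  set v : ℕ → ℝ := fun m => m * cgf X μ (2 * c / m) - 2 * (m * cgf X μ (c / m)) with hv
  have hw : (fun m : ℕ => v m - c ^ 2 * Var[X; μ] / m) =O[atTop] fun m : ℕ => (1 / (m : ℝ)) ^ 2 := by
    refine ((natCast_mul_cgf_isBigO h (2 * c)).sub
      ((natCast_mul_cgf_isBigO h c).const_mul_left 2)).congr_left fun m => ?_
    simp only [hv]; ring
  have hv1 : v =O[atTop] fun m : ℕ => 1 / (m : ℝ) := by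
    have h2 : (fun m : ℕ => c ^ 2 * Var[X; μ] / m) =O[atTop] fun m : ℕ => 1 / (m : ℝ) := by
      simpa [div_eq_mul_inv] using
        (isBigO_refl (fun m : ℕ => (m : ℝ)⁻¹) atTop).const_mul_left (c ^ 2 * Var[X; μ])
    refine ((hw.trans one_div_sq_isBigO).add h2).congr_left fun m => ?_
    ring
  have hv0 : Tendsto v atTop (𝓝 0) := hv1.trans_tendsto (tendsto_div_natCast 1)
  have he := ((Real.exp_sub_sum_range_isBigO_pow 2).comp_tendsto hv0).trans (hv1.pow 2)
  have hm := (isBigO_refl (fun m : ℕ => (m : ℝ)) atTop).mul (he.add hw)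
  refine hm.congr' ?_ ?_
  · filter_upwards [eventually_mgf_eq_exp_cgf h c, eventually_mgf_eq_exp_cgf h (2 * c),
      eventually_gt_atTop 0] with m h1 h2 hm
    have hm : (0 : ℝ) < m := by exact_mod_cast hm
    have : mgf X μ (c / m) ^ (-(2 * (m : ℤ))) * mgf X μ (2 * c / m) ^ m = Real.exp (v m) := by
      rw [h1, h2, zpow_neg, zpow_mul, zpow_natCast, zpow_ofNat, ← Real.exp_nat_mul,
        ← Real.exp_nat_mul, ← Real.exp_nat_mul, ← Real.exp_neg, ← Real.exp_add]
      congr 1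
      simp only [hv]; push_cast; ring
    rw [this]
    simp [Finset.sum_range_succ]
    field_simp
    ring
  · filter_upwards [eventually_gt_atTop 0] with m hm
    have hm : (0 : ℝ) < m := by exact_mod_cast hm
    field_simp

end

/-! ### The memory is linear in the stream state -/

lemma memoryState_eq_sum {F : Type*} [Field F] {n : ℕ} (h g : Fin n → ℤ → F)
    (σ : List (Fin n × F)) (i : ℤ) :
    memoryState h g σ i = ∑ v, streamState σ v * (h v i * g v i) := by
  induction σ using List.reverseRecOn with
  | nil => simp [memoryState, streamState]
  | append_singleton σ u ih =>
    have hs : streamState (σ ++ [u]) =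
        Function.update (streamState σ) u.1 (streamState σ u.1 + u.2) := by
      simp [streamState]
    have hm : memoryState h g (σ ++ [u]) i =
        memoryState h g σ i + u.2 * (h u.1 i * g u.1 i) := by
      simp [memoryState]
    rw [hm, ih, hs, ← Finset.add_sum_erase _ _ (Finset.mem_univ u.1),
      ← Finset.add_sum_erase _ _ (Finset.mem_univ u.1), Function.update_self]
    have : ∀ v ∈ Finset.univ.erase u.1, Function.update (streamState σ) u.1
        (streamState σ u.1 + u.2) v * (h v i * g v i) = streamState σ v * (h v i * g v i) :=
      fun v hv => by rw [Function.update_of_ne (Finset.ne_of_mem_erase hv)]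
    rw [Finset.sum_congr rfl this]
    ring

/-! ### The law of one cell -/

section Mixture

variable {F : Type*} [Field F] [Fintype F] [DecidableEq F] [MeasurableSpace F]
  [MeasurableSingletonClass F] {Ω : Type*} [MeasurableSpace Ω]

/-- `X` takes values in the finite field `F` with law `α δ₀ + (1 - α) U`, where `U` is uniform. -/
def IsZeroUniformMixture (X : Ω → F) (P : Measure Ω) (α : ℝ) : Prop :=
  ∀ a, P.real (X ⁻¹' {a}) = α * (if a = 0 then 1 else 0) + (1 - α) / Fintype.card F

/-- Adding an independent uniform variable gives a uniform one, so the weights of the point mass at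
zero multiply. -/
lemma IsZeroUniformMixture.add {X Y : Ω → F} {P : Measure Ω} [IsProbabilityMeasure P] {α β : ℝ}
    (hX : IsZeroUniformMixture X P α) (hY : IsZeroUniformMixture Y P β) (hXm : Measurable X)
    (hYm : Measurable Y) (h : IndepFun X Y P) :
    IsZeroUniformMixture (X + Y) P (α * β) := by
  intro a
  have hU : (X + Y) ⁻¹' {a} = ⋃ b ∈ (Finset.univ : Finset F), X ⁻¹' {b} ∩ Y ⁻¹' {a - b} := by
    ext ω
    simp [eq_sub_iff_add_eq, add_comm]
  have hq : (Fintype.card F : ℝ) ≠ 0 := by simp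
  rw [hU, measureReal_biUnion_finset]
  · have hb : ∀ b, P.real (X ⁻¹' {b} ∩ Y ⁻¹' {a - b}) =
        (α * (if b = 0 then 1 else 0) + (1 - α) / Fintype.card F) *
          (β * (if a = b then 1 else 0) + (1 - β) / Fintype.card F) := fun b => by
      rw [measureReal_def, h.measure_inter_preimage_eq_mul _ _ (.singleton _) (.singleton _),
        ENNReal.toReal_mul, ← measureReal_def, ← measureReal_def, hX, hY]
      simp only [sub_eq_zero]
    simp only [hb, mul_add, add_mul, Finset.sum_add_distrib, mul_ite, ite_mul, mul_one, mul_zero,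
      zero_mul, Finset.sum_ite_eq, Finset.sum_ite_eq', Finset.mem_univ, if_true, Finset.sum_const,
      Finset.card_univ, nsmul_eq_mul]
    split_ifs <;> field_simp <;> ring
  · intro b _ c _ hbc
    refine Set.disjoint_left.2 fun ω h1 h2 => hbc ?_
    exact h1.1.symm.trans h2.1
  · exact fun b _ => (hXm (.singleton _)).inter (hYm (.singleton _))

lemma IsZeroUniformMixture.sum {ι : Type*} {X : ι → Ω → F} {P : Measure Ω}
    [IsProbabilityMeasure P] {α : ι → ℝ} (hX : ∀ i, IsZeroUniformMixture (X i) P (α i))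
    (hXm : ∀ i, Measurable (X i)) (h : iIndepFun X P) (s : Finset ι) :
    IsZeroUniformMixture (∑ i ∈ s, X i) P (∏ i ∈ s, α i) := by
  classical
  induction s using Finset.induction_on with
  | empty =>
    intro a
    by_cases ha : a = 0
    · subst ha
      have : (0 : Ω → F) ⁻¹' {0} = Set.univ := by ext; simp
      simp [this]
    · have : (0 : Ω → F) ⁻¹' {a} = ∅ := by ext; simp [Ne.symm ha]
      simp [ha, this]
  | insert i s hi ih =>
    rw [Finset.sum_insert hi, Finset.prod_insert hi]
    exact (hX i).add ih (hXm i) (by simpa only [Finset.sum_fn] using Finset.measurable_sum s fun j _ => hXm j)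
      (h.indepFun_finsetSum_of_notMem hXm hi).symm

/-- One update coordinate contributes a uniform value if it is hit and its weight is nonzero, and
zero otherwise. -/
lemma isZeroUniformMixture_entryLaw (m : ℕ) (i : ℤ) (θ : ℝ) (x : F) :
    IsZeroUniformMixture (fun e : F × F => x * (e.1 * e.2)) (entryLaw F m i θ)
      (if x = 0 then 1 else missProb m i θ) := by
  intro a
  by_cases hx : x = 0
  · by_cases ha : a = 0
    · simp [hx, ha]
    · have : (fun _ : F × F => (0 : F)) ⁻¹' {a} = ∅ := by ext; simp [Ne.symm ha]
      simp [hx, ha, this]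
  have h1 : 0 ≤ missProb m i θ := (Real.exp_pos _).le
  have h2 : 0 ≤ 1 - missProb m i θ := sub_nonneg.2 (missProb_le_one m i θ)
  have hm : Measurable fun e : F × F => x * (e.1 * e.2) := .of_discrete
  have hu : Prod.mk (1 : F) ⁻¹' ((fun e : F × F => x * (e.1 * e.2)) ⁻¹' {a}) = {x⁻¹ * a} := by
    ext g
    simp [eq_inv_mul_iff_mul_eq₀ hx]
  have hz : (PMF.uniformOfFintype F).toMeasure
      (Prod.mk (0 : F) ⁻¹' ((fun e : F × F => x * (e.1 * e.2)) ⁻¹' {a})) =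
        if a = 0 then 1 else 0 := by
    by_cases ha : a = 0
    · have : Prod.mk (0 : F) ⁻¹' ((fun e : F × F => x * (e.1 * e.2)) ⁻¹' {a}) = Set.univ := by
        ext; simp [ha]
      rw [this]; simp [ha]
    · have : Prod.mk (0 : F) ⁻¹' ((fun e : F × F => x * (e.1 * e.2)) ⁻¹' {a}) = ∅ := by
        ext; simp [Ne.symm ha]
      rw [this]; simp [ha]
  rw [measureReal_def, entryLaw, Measure.prod_apply (hm (.singleton _)), hitLaw,
    lintegral_add_measure, lintegral_smul_measure, lintegral_smul_measure, lintegral_dirac,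
    lintegral_dirac, hu, hz, PMF.toMeasure_apply_singleton _ _ (.singleton _), smul_eq_mul,
    smul_eq_mul, ENNReal.toReal_add, ENNReal.toReal_mul, ENNReal.toReal_mul,
    ENNReal.toReal_ofReal h1, ENNReal.toReal_ofReal h2]
  · by_cases ha : a = 0 <;> simp [ha, hx, div_eq_mul_inv]
  · split_ifs <;> simp
  · exact ENNReal.mul_ne_top ENNReal.ofReal_ne_top (by simp)

end Mixture

section Cells

variable {F : Type*} [Field F] [Fintype F] [MeasurableSpace F] [MeasurableSingletonClass F] {n : ℕ}

/-- The content of a cell as a function of its column of the tables, for the stream state `x`. -/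
def cellValue (x : Fin n → F) (e : Fin n → F × F) : F := ∑ v, x v * ((e v).1 * (e v).2)

/-- The law of the content of cell `i` for the stream state `x`, given the offset. -/
noncomputable def cellLaw (m : ℕ) (x : Fin n → F) (θ : ℝ) (i : ℤ) : Measure F :=
  (Measure.infinitePi fun _ : Fin n => entryLaw F m i θ).map (cellValue x)

lemma measurable_cellValue (x : Fin n → F) : Measurable (cellValue x) := .of_discrete

instance (m : ℕ) (x : Fin n → F) (θ : ℝ) (i : ℤ) : IsProbabilityMeasure (cellLaw m x θ i) :=
  Measure.isProbabilityMeasure_map (measurable_cellValue x).aemeasurable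

lemma cellLaw_zero [DecidableEq F] (m : ℕ) (x : Fin n → F) (θ : ℝ) (i : ℤ) :
    (cellLaw m x θ i).real {0} =
      1 - (1 - missProb m i θ ^ hammingNorm x) * (1 - (Fintype.card F : ℝ)⁻¹) := by
  have hs : cellValue x = ∑ v, fun e : Fin n → F × F => x v * ((e v).1 * (e v).2) := by
    ext e; simp [cellValue]
  have hmix : ∀ v, IsZeroUniformMixture (fun e : Fin n → F × F => x v * ((e v).1 * (e v).2))
      (Measure.infinitePi fun _ : Fin n => entryLaw F m i θ)
      (if x v = 0 then 1 else missProb m i θ) := fun v a => by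
    have he := isZeroUniformMixture_entryLaw m i θ (x v) a
    rwa [← Measure.infinitePi_map_eval (fun _ : Fin n => entryLaw F m i θ) v,
      map_measureReal_apply (by fun_prop) (.of_discrete)] at he
  have hind : iIndepFun (fun v (e : Fin n → F × F) => x v * ((e v).1 * (e v).2))
      (Measure.infinitePi fun _ : Fin n => entryLaw F m i θ) :=
    iIndepFun_infinitePi (X := fun v (e : F × F) => x v * (e.1 * e.2)) fun _ => .of_discrete
  have h := IsZeroUniformMixture.sum hmix (fun _ => .of_discrete) hind Finset.univ 0
  rw [← hs, Finset.prod_ite, Finset.prod_const_one, one_mul, Finset.prod_const] at h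
  rw [cellLaw, map_measureReal_apply (measurable_cellValue x) (.singleton _), h]
  simp only [hammingNorm, if_true, ne_eq]
  ring

lemma cellLaw_zero_eq_occupancy [DecidableEq F] {m : ℕ} (hm : 0 < m) {x : Fin n → F} (hx : x ≠ 0) (θ : ℝ)
    (i : ℤ) :
    (cellLaw m x θ i).real {0} =
      1 - occupancy (θ + i - Real.logb 2 (hammingNorm x / m)) *
        (1 - (Fintype.card F : ℝ)⁻¹) := by
  have hN : (0 : ℝ) < hammingNorm x := by exact_mod_cast hammingNorm_pos_iff.2 hx
  have hm' : (0 : ℝ) < m := by exact_mod_cast hm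
  rw [cellLaw_zero, occupancy, missProb, ← Real.exp_nat_mul]
  congr 4
  rw [show -(θ + i - Real.logb 2 (hammingNorm x / m)) =
    Real.logb 2 (hammingNorm x / m) + (-(i : ℝ) - θ) by ring, Real.rpow_add two_pos,
    Real.rpow_logb two_pos (by norm_num) (by positivity)]
  ring

/-- Given the offset, the cells are independent. -/
lemma map_cellValue_tableKernel (m : ℕ) (x : Fin n → F) (θ : ℝ) :
    (tableKernel F m n θ).map (fun t i => cellValue x fun v => t (v, i)) =
      Measure.infinitePi (cellLaw m x θ) := by
  have hcol : (Measure.infinitePi fun p : Fin n × ℤ => entryLaw F m p.2 θ).map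
      (fun t i v => t (v, i)) =
        Measure.infinitePi fun i : ℤ => Measure.infinitePi fun _ : Fin n => entryLaw F m i θ := by
    -- Swap the two indices of the tables and curry.
    rw [← Measure.infinitePi_map_piCongrLeft (fun p : Fin n × ℤ => entryLaw F m p.2 θ)
      (Equiv.prodComm ℤ (Fin n)), Measure.map_map (by fun_prop) (by fun_prop),
      ← Measure.infinitePi_map_curry (fun (i : ℤ) (_ : Fin n) => entryLaw F m i θ)]
    rfl
  have h := Measure.infinitePi_map_pi
    (fun i : ℤ => Measure.infinitePi fun _ : Fin n => entryLaw F m i θ)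
    (fun _ => measurable_cellValue x)
  rw [← hcol, Measure.map_map] at h
  · exact h
  · exact measurable_pi_iff.2 fun i => (measurable_cellValue x).comp (measurable_pi_apply i)
  · fun_prop

end Cells

/-! ### The law of the highest position -/

section Position

variable {F : Type*} [Field F]

/-- The memory states in which all cells strictly above `i` are zero. -/
def zeroAboveSet (F : Type*) [Field F] (i : ℤ) : Set (ℤ → F) := {s | ∀ j, i < j → s j = 0}

lemma zeroAboveSet_eq_iInter (i : ℤ) : zeroAboveSet F i =
    ⋂ k : ℕ, ((Finset.Ioc i (i + k) : Finset ℤ) : Set ℤ).pi fun _ => ({0} : Set F) := by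
  ext s
  simp only [zeroAboveSet, Set.mem_ofPred_eq, Set.mem_iInter, Set.mem_pi, Finset.coe_Ioc,
    Set.mem_Ioc, Set.mem_singleton_iff]
  exact ⟨fun h k j hj => h j hj.1, fun h j hj => h (j - i).toNat j ⟨hj, by omega⟩⟩

lemma monotone_zeroAboveSet : Monotone (zeroAboveSet F) :=
  fun _ _ hij _ hs k hk => hs k (hij.trans_lt hk)

lemma highestIndex_eq_of_mem {i : ℤ} {s : ℤ → F} (h : s ∈ zeroAboveSet F i \ zeroAboveSet F (i - 1)) :
    highestIndex s = ((i : ℝ) : EReal) := by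
  obtain ⟨h1, h2⟩ := h
  have hi : s i ≠ 0 := by
    intro hi
    refine h2 fun j hj => ?_
    rcases (Int.le_of_sub_one_lt hj).eq_or_lt with rfl | hj
    · exact hi
    · exact h1 j hj
  refine le_antisymm (iSup₂_le fun j hj => ?_) (le_iSup₂_of_le i hi le_rfl)
  have : j ≤ i := not_lt.1 fun hij => hj (h1 j hij)
  exact_mod_cast this

variable [MeasurableSpace F] [MeasurableSingletonClass F]

lemma measurableSet_zeroAboveSet (i : ℤ) : MeasurableSet (zeroAboveSet F i) := by
  rw [zeroAboveSet_eq_iInter]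
  exact .iInter fun k => .pi (Finset.countable_toSet _) fun _ _ => .singleton _

lemma measurable_highestIndex : Measurable (highestIndex (F := F)) := by
  refine Measurable.iSup fun i => ?_
  have : MeasurableSet {s : ℤ → F | i ∈ {i : ℤ | s i ≠ 0}} :=
    (measurable_pi_apply i (.singleton 0)).compl
  classical
  have he : (fun s : ℤ → F => ⨆ (_ : i ∈ {i : ℤ | s i ≠ 0}), ((i : ℝ) : EReal)) =
      fun s => if i ∈ {i : ℤ | s i ≠ 0} then ((i : ℝ) : EReal) else ⊥ := by
    ext s
    split_ifs with h <;> simp [h]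
  rw [he]
  exact Measurable.ite this measurable_const measurable_const

lemma measurable_highestPosition :
    Measurable fun p : ℝ × (ℤ → F) => highestPosition p.2 p.1 := by
  unfold highestPosition
  exact (measurable_highestIndex.comp measurable_snd).add
    (measurable_coe_real_ereal.comp measurable_fst)

variable {μ : ℤ → Measure F} [∀ i, IsProbabilityMeasure (μ i)] {w r : ℝ}

lemma infinitePi_zeroAboveSet (hr1 : r ≤ 1)
    (hμ : ∀ i, (μ i).real {0} = 1 - occupancy (w + i) * r) (i : ℤ) :
    Measure.infinitePi μ (zeroAboveSet F i) = ENNReal.ofReal (zeroAbove (w + i) r) := by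
  rw [zeroAboveSet_eq_iInter]
  have hlim := tendsto_measure_iInter_atTop (μ := Measure.infinitePi μ)
    (s := fun k : ℕ => ((Finset.Ioc i (i + k) : Finset ℤ) : Set ℤ).pi fun _ => ({0} : Set F))
    (fun k => (MeasurableSet.pi (Finset.countable_toSet _)
      fun _ _ => .singleton _).nullMeasurableSet)
    (fun k l hkl => Set.pi_mono' (fun _ _ => subset_rfl) (by
      intro j; simp only [Finset.coe_Ioc, Set.mem_Ioc]; omega)) ⟨0, measure_ne_top _ _⟩
  refine tendsto_nhds_unique hlim ?_
  have hfin : ∀ k : ℕ, Measure.infinitePi μ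
      (((Finset.Ioc i (i + k) : Finset ℤ) : Set ℤ).pi fun _ => ({0} : Set F)) =
        ENNReal.ofReal (∏ j ∈ Finset.range k, (1 - occupancy (w + i + ((j : ℝ) + 1)) * r)) := by
    intro k
    rw [Measure.infinitePi_pi _ fun _ _ => .singleton _, ENNReal.ofReal_prod_of_nonneg
      fun j _ => (one_sub_occupancy_mul_pos hr1 _).le]
    refine (Finset.prod_bij (fun (j : ℕ) _ => i + (j + 1)) ?_ ?_ ?_ ?_).symm
    · intro j hj
      simp only [Finset.mem_range, Finset.mem_Ioc] at hj ⊢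
      omega
    · intro j _ k _ h
      omega
    · intro l hl
      simp only [Finset.mem_Ioc] at hl
      exact ⟨(l - i - 1).toNat, by simp only [Finset.mem_range]; omega, by omega⟩
    · intro j _
      rw [← ofReal_measureReal, hμ]
      push_cast
      rw [add_assoc]
  simp only [Function.comp_def, hfin]
  exact (ENNReal.continuous_ofReal.tendsto _).comp
    (multipliable_zeroAbove (w + i) r).hasProd.tendsto_prod_nat

/-- If the cells are independent and cell `i` is nonzero with probability `occupancy (w + i) * r`,
then the highest nonzero cell is `i` with probability `ν(w + i, r)`. -/
lemma lintegral_highestIndex (hr : 1 / 2 ≤ r) (hr1 : r ≤ 1)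
    (hμ : ∀ i, (μ i).real {0} = 1 - occupancy (w + i) * r) (f : EReal → ℝ≥0∞) :
    ∫⁻ s, f (highestIndex s) ∂Measure.infinitePi μ =
      ∑' i : ℤ, ENNReal.ofReal (nu (w + i) r) * f ((i : ℝ) : EReal) := by
  set A : ℤ → Set (ℤ → F) := fun i => zeroAboveSet F i \ zeroAboveSet F (i - 1) with hA
  have hAm : ∀ i, MeasurableSet (A i) := fun i =>
    (measurableSet_zeroAboveSet i).diff (measurableSet_zeroAboveSet (i - 1))
  have hAd : Pairwise (Function.onFun Disjoint A) := by
    intro i j hij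
    refine Set.disjoint_left.2 fun s hi hj => hij ?_
    have := (highestIndex_eq_of_mem hi).symm.trans (highestIndex_eq_of_mem hj)
    exact_mod_cast this
  have hAμ : ∀ i, Measure.infinitePi μ (A i) = ENNReal.ofReal (nu (w + i) r) := fun i => by
    rw [hA, measure_sdiff (monotone_zeroAboveSet (by omega))
      (measurableSet_zeroAboveSet _).nullMeasurableSet (measure_ne_top _ _),
      infinitePi_zeroAboveSet hr1 hμ, infinitePi_zeroAboveSet hr1 hμ, nu_eq_sub,
      ENNReal.ofReal_sub _ (zeroAbove_nonneg hr1 _)]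
    push_cast
    rw [add_sub_assoc]
  -- The highest index exists almost surely, since its probabilities sum to one.
  have hU : ∀ᵐ s ∂Measure.infinitePi μ, s ∈ ⋃ i, A i := by
    refine (mem_ae_iff_prob_eq_one (MeasurableSet.iUnion hAm)).2 ?_
    rw [measure_iUnion hAd hAm]
    simp only [hAμ]
    exact tsum_ofReal_nu_add_int hr hr1 w
  have hU' : (⋃ i, A i) =ᵐ[Measure.infinitePi μ] Set.univ := eventuallyEq_univ.2 hU
  rw [← setLIntegral_univ, ← setLIntegral_congr hU', lintegral_iUnion hAm hAd]
  refine tsum_congr fun i => ?_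
  rw [setLIntegral_congr_fun (hAm i) (g := fun _ => f ((i : ℝ) : EReal))
    fun s hs => by rw [highestIndex_eq_of_mem hs], setLIntegral_const, hAμ, mul_comm]

end Position

section PositionLaw

variable {F : Type*} [Field F] [Fintype F] [MeasurableSpace F] [MeasurableSingletonClass F] {n : ℕ}

lemma one_half_le_one_sub_inv_card (F : Type*) [Field F] [Fintype F] :
    1 / 2 ≤ 1 - (Fintype.card F : ℝ)⁻¹ := by
  have h : (2 : ℝ) ≤ Fintype.card F := by exact_mod_cast Fintype.one_lt_card (α := F)
  have := inv_anti₀ two_pos h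
  linarith

lemma one_sub_inv_card_le_one (F : Type*) [Fintype F] : 1 - (Fintype.card F : ℝ)⁻¹ ≤ 1 :=
  sub_le_self _ (by positivity)

lemma measurable_cells (x : Fin n → F) :
    Measurable fun (t : Fin n × ℤ → F × F) (i : ℤ) => cellValue x fun v => t (v, i) :=
  measurable_pi_iff.2 fun i => (measurable_cellValue x).comp
    (measurable_pi_iff.2 fun v => measurable_pi_apply (v, i))

/-- The highest position as a function of the offset and the tables, for the stream state `x`. -/
noncomputable def cellsPosition (x : Fin n → F) (p : ℝ × (Fin n × ℤ → F × F)) : EReal :=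
  highestPosition (fun i => cellValue x fun v => p.2 (v, i)) p.1

lemma measurable_cellsPosition (x : Fin n → F) : Measurable (cellsPosition x) := by
  have h : Measurable fun p : ℝ × (Fin n × ℤ → F × F) =>
      fun (i : ℤ) => cellValue x fun v => p.2 (v, i) :=
    (measurable_cells x).comp measurable_snd
  have he : cellsPosition x = (fun p : ℝ × (ℤ → F) => highestPosition p.2 p.1) ∘
      fun p => (p.1, fun i => cellValue x fun v => p.2 (v, i)) := rfl
  rw [he]
  exact measurable_highestPosition.comp (measurable_fst.prodMk h)

/-- The uniform offset turns the lattice laws of the highest index into the shift by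
`log₂ (‖x‖₀ / m)` of the law with density `ν`. -/
lemma map_cellsPosition_subsketchLaw {m : ℕ} (hm : 0 < m) [DecidableEq F] {x : Fin n → F}
    (hx : x ≠ 0) :
    (subsketchLaw F m n).map (cellsPosition x) = (nuLaw (1 - (Fintype.card F : ℝ)⁻¹)).map
      fun z : ℝ => ((z + Real.logb 2 (hammingNorm x / m) : ℝ) : EReal) := by
  set a := Real.logb 2 (hammingNorm x / m) with ha
  have hr := one_half_le_one_sub_inv_card F
  have hr1 := one_sub_inv_card_le_one F
  set r := 1 - (Fintype.card F : ℝ)⁻¹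
  have hnu := measurable_nu r
  have hc : ∀ b : ℝ, Measurable fun z : ℝ => ((z + b : ℝ) : EReal) := fun b =>
    measurable_coe_real_ereal.comp (measurable_id.add_const b)
  refine Measure.ext_of_lintegral _ fun f hf => ?_
  have hinner : ∀ θ : ℝ, ∫⁻ t, f (cellsPosition x (θ, t)) ∂tableKernel F m n θ =
      ∑' i : ℤ, ENNReal.ofReal (nu (θ + i - a) r) * f ((θ + i : ℝ) : EReal) := fun θ => by
    have h := lintegral_highestIndex (μ := cellLaw m x θ) (w := θ - a) hr hr1
      (fun i => by rw [cellLaw_zero_eq_occupancy hm hx, sub_add_eq_add_sub])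
      fun w => f (w + (θ : EReal))
    rw [← map_cellValue_tableKernel, lintegral_map _ (measurable_cells x)] at h
    · refine h.trans (tsum_congr fun i => ?_)
      rw [sub_add_eq_add_sub, ← EReal.coe_add, add_comm (i : ℝ)]
    · exact hf.comp (measurable_highestIndex.add_const _)
  rw [lintegral_map hf (measurable_cellsPosition x), subsketchLaw,
    Measure.lintegral_compProd (f := fun p => f (cellsPosition x p))
      (hf.comp (measurable_cellsPosition x))]
  simp only [hinner]
  have hg : Measurable fun z : ℝ => ENNReal.ofReal (nu (z - a) r) * f (z : EReal) :=
    (hnu.comp (measurable_id.sub_const a)).ennreal_ofReal.mul (hf.comp measurable_coe_real_ereal)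
  rw [← lintegral_eq_lintegral_Ico_tsum hg, lintegral_map hf (hc a),
    lintegral_nuLaw r (f := fun z => f ((z + a : ℝ) : EReal)) (hf.comp (hc a)), ← lintegral_add_right_eq_self _ a]
  simp only [add_sub_cancel_right]

end PositionLaw

/-! ### Moments of the geometric mean of the positions -/

lemma twoPow_coe (w : ℝ) : twoPow (w : EReal) = (2 : ℝ) ^ w := by
  rw [twoPow, ← EReal.coe_mul, EReal.exp_coe, ENNReal.toReal_ofReal (Real.exp_pos _).le,
    Real.rpow_def_of_pos two_pos]

lemma sum_coe_ereal {ι : Type*} (s : Finset ι) (y : ι → ℝ) :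
    ∑ i ∈ s, (y i : EReal) = ((∑ i ∈ s, y i : ℝ) : EReal) := by
  classical
  induction s using Finset.induction_on with
  | empty => simp
  | insert i s hi ih => rw [Finset.sum_insert hi, Finset.sum_insert hi, ih, EReal.coe_add]

lemma twoPowMean_coe {m : ℕ} (y : Fin m → ℝ) :
    twoPowMean (fun k => (y k : EReal)) = ∏ k, (2 : ℝ) ^ ((m : ℝ)⁻¹ * y k) := by
  rw [twoPowMean, sum_coe_ereal, ← EReal.coe_mul, twoPow_coe, Finset.mul_sum,
    Real.rpow_sum_of_pos two_pos]

lemma twoPowMean_bot {m : ℕ} (hm : 0 < m) : twoPowMean (fun _ : Fin m => (⊥ : EReal)) = 0 := by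
  have : NeZero m := ⟨hm.ne'⟩
  have hs : ∑ _k : Fin m, (⊥ : EReal) = ⊥ := by
    rw [← Finset.add_sum_erase _ _ (Finset.mem_univ (0 : Fin m)), EReal.bot_add]
  have hm' : (0 : ℝ) < (m : ℝ)⁻¹ := by positivity
  rw [twoPowMean, hs, EReal.coe_mul_bot_of_pos hm', twoPow,
    EReal.coe_mul_bot_of_pos (Real.log_pos one_lt_two)]
  simp

section Moments

variable {Ω : Type*} [MeasurableSpace Ω] {P : Measure Ω} {m : ℕ} {W : Fin m → Ω → EReal} {r a : ℝ}

/-- Almost surely all positions are finite, and then the power of two of their mean is a product. -/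
lemma ae_twoPowMean_eq_prod (hW : ∀ k, AEMeasurable (W k) P)
    (hlaw : ∀ k, P.map (W k) = (nuLaw r).map fun z : ℝ => ((z + a : ℝ) : EReal)) :
    ∀ᵐ ω ∂P, twoPowMean (fun k => W k ω) =
      ∏ k, (2 : ℝ) ^ ((m : ℝ)⁻¹ * (W k ω).toReal) := by
  have hc : Measurable fun z : ℝ => ((z + a : ℝ) : EReal) :=
    measurable_coe_real_ereal.comp (measurable_id.add_const a)
  have h : ∀ k, ∀ᵐ ω ∂P, ((W k ω).toReal : EReal) = W k ω := fun k => by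
    refine ae_of_ae_map (hW k) (p := fun w : EReal => (w.toReal : EReal) = w) ?_
    rw [hlaw k, ae_map_iff hc.aemeasurable]
    · exact ae_of_all _ fun z => by rw [EReal.toReal_coe]
    · exact measurableSet_eq_fun (measurable_coe_real_ereal.comp measurable_ereal_toReal)
        measurable_id
  filter_upwards [ae_all_iff.2 h] with ω hω
  rw [← twoPowMean_coe]
  simp only [hω]

/-- The moments of the geometric mean factor over the independent positions. -/
lemma integral_twoPowMean_pow (hr : 1 / 2 ≤ r) (hr1 : r ≤ 1) (hW : ∀ k, AEMeasurable (W k) P)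
    (hind : iIndepFun W P)
    (hlaw : ∀ k, P.map (W k) = (nuLaw r).map fun z : ℝ => ((z + a : ℝ) : EReal)) (j : ℕ)
    (hm : 0 < m) :
    ∫ ω, twoPowMean (fun k => W k ω) ^ j ∂P = ((2 : ℝ) ^ a) ^ j * phi (j / m) r ^ m := by
  have hm' : (m : ℝ) ≠ 0 := by exact_mod_cast hm.ne'
  set g : EReal → ℝ := fun w => ((2 : ℝ) ^ ((m : ℝ)⁻¹ * w.toReal)) ^ j with hg
  have hgm : Measurable g := by
    have := measurable_ereal_toReal
    fun_prop
  have hc : Measurable fun z : ℝ => ((z + a : ℝ) : EReal) :=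
    measurable_coe_real_ereal.comp (measurable_id.add_const a)
  have h1 : ∫ ω, twoPowMean (fun k => W k ω) ^ j ∂P = ∫ ω, ∏ k, g (W k ω) ∂P := by
    refine integral_congr_ae ?_
    filter_upwards [ae_twoPowMean_eq_prod hW hlaw] with ω hω
    rw [hω, Finset.prod_pow]
  have h2 : ∀ k, ∫ ω, g (W k ω) ∂P = (2 : ℝ) ^ (j / m * a) * phi (j / m) r := fun k => by
    rw [← integral_map (hW k) hgm.aestronglyMeasurable, hlaw k,
      integral_map hc.aemeasurable hgm.aestronglyMeasurable,
      integral_nuLaw (by linarith) hr1, phi, ← integral_const_mul]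
    refine integral_congr_ae (ae_of_all _ fun z => ?_)
    simp only [hg, EReal.toReal_coe]
    rw [← Real.rpow_mul_natCast two_pos.le, mul_comm (nu z r), ← mul_assoc,
      ← Real.rpow_add two_pos]
    congr 2
    field_simp
    ring
  rw [h1, hind.integral_fun_prod_comp hW fun _ => hgm.aestronglyMeasurable]
  simp only [h2, Finset.prod_const, Finset.card_univ, Fintype.card_fin, mul_pow]
  rw [← Real.rpow_mul_natCast two_pos.le, ← Real.rpow_mul_natCast two_pos.le]
  congr 2
  field_simp

lemma memLp_twoPowMean (hr : 1 / 2 ≤ r) (hr1 : r ≤ 1) (hW : ∀ k, AEMeasurable (W k) P)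
    (hind : iIndepFun W P)
    (hlaw : ∀ k, P.map (W k) = (nuLaw r).map fun z : ℝ => ((z + a : ℝ) : EReal))
    (hm : 3 ≤ m) : MemLp (fun ω => twoPowMean fun k => W k ω) 2 P := by
  have hmeas : AEStronglyMeasurable (fun ω => twoPowMean fun k => W k ω) P := by
    have he : (fun ω => twoPowMean fun k => W k ω) =ᵐ[P]
      fun ω => ∏ k, (2 : ℝ) ^ ((m : ℝ)⁻¹ * (W k ω).toReal) := ae_twoPowMean_eq_prod hW hlaw
    refine (AEMeasurable.congr ?_ he.symm).aestronglyMeasurable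
    refine Finset.aemeasurable_fun_prod _ fun k _ => ?_
    have := measurable_ereal_toReal.comp_aemeasurable (hW k)
    fun_prop
  have hm' : (3 : ℝ) ≤ m := by exact_mod_cast hm
  rw [memLp_two_iff_integrable_sq hmeas]
  -- The Bochner integral of a non-integrable function is zero, so it suffices that this one is not.
  refine Integrable.of_integral_ne_zero ?_
  rw [integral_twoPowMean_pow hr hr1 hW hind hlaw 2 (by omega)]
  have := phi_pos hr hr1 (t := (2 : ℕ) / m) (by positivity)
    ((div_lt_one (by linarith)).2 (by push_cast; linarith))
  positivity

end Moments

/-! ### The estimator -/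

section Estimator

variable {F : Type*} [Field F] {m n : ℕ} {Ω : Type*}

lemma position_eq_cellsPosition (Θ : Fin m → Ω → ℝ) (H G : Fin m → Fin n → ℤ → Ω → F)
    (σ : List (Fin n × F)) (k : Fin m) (ω : Ω) :
    position Θ H G σ k ω = cellsPosition (streamState σ)
      (Θ k ω, fun p : Fin n × ℤ => (H k p.1 p.2 ω, G k p.1 p.2 ω)) := by
  unfold position cellsPosition cellValue
  congr 1
  ext i
  exact memoryState_eq_sum _ _ σ i

lemma position_eq_bot {Θ : Fin m → Ω → ℝ} {H G : Fin m → Fin n → ℤ → Ω → F}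
    {σ : List (Fin n × F)} (hσ : streamState σ = 0) (k : Fin m) (ω : Ω) :
    position Θ H G σ k ω = ⊥ := by
  simp [position_eq_cellsPosition, cellsPosition, highestPosition, highestIndex, cellValue, hσ]

variable [Fintype F] [DecidableEq F] [MeasurableSpace F] [MeasurableSingletonClass F]
  [MeasurableSpace Ω] {P : Measure Ω} [IsProbabilityMeasure P] {Θ : Fin m → Ω → ℝ}
  {H G : Fin m → Fin n → ℤ → Ω → F}

/-- The positions are independent copies of `Z + log₂ (‖x‖₀ / m)` with `Z` of density `ν`, so the
moments of the estimator are products; for the zero stream state all positions are `-∞`. -/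
lemma estimator_moments (hm : 3 ≤ m) (h : IsSketchRandomness P Θ H G) (σ : List (Fin n × F)) :
    MemLp (fun ω => estimator (Fintype.card F) fun k => position Θ H G σ k ω) 2 P ∧
    ∫ ω, estimator (Fintype.card F) (fun k => position Θ H G σ k ω) ∂P =
      hammingNorm (streamState σ) ∧
    variance (fun ω => estimator (Fintype.card F) fun k => position Θ H G σ k ω) P =
      (phi (1 / (m : ℝ)) (1 - (Fintype.card F : ℝ)⁻¹) ^ (-(2 * (m : ℤ))) *
        phi (2 / (m : ℝ)) (1 - (Fintype.card F : ℝ)⁻¹) ^ m - 1) *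
        (hammingNorm (streamState σ) : ℝ) ^ 2 := by
  by_cases hx : streamState σ = 0
  · have h0 : ∀ ω, estimator (Fintype.card F) (fun k => position Θ H G σ k ω) = 0 := fun ω => by
      simp only [estimator, position_eq_bot hx, twoPowMean_bot (m := m) (by omega), mul_zero]
    simp only [h0, hx]
    exact ⟨MemLp.zero', by simp, (variance_zero P).trans (by simp)⟩
  have hr := one_half_le_one_sub_inv_card F
  have hr1 := one_sub_inv_card_le_one F
  have hm' : (3 : ℝ) ≤ m := by exact_mod_cast hm
  have hN : (0 : ℝ) < hammingNorm (streamState σ) := by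
    exact_mod_cast hammingNorm_pos_iff.2 hx
  set x := streamState σ with hxdef
  have hW : ∀ k, AEMeasurable (position Θ H G σ k) P := fun k => by
    refine ((measurable_cellsPosition x).comp_aemeasurable (h.hasLaw k).aemeasurable).congr ?_
    exact ae_of_all _ fun ω => (position_eq_cellsPosition Θ H G σ k ω).symm
  have hfun : ∀ k, position Θ H G σ k = cellsPosition x ∘
      fun ω => (Θ k ω, fun p : Fin n × ℤ => (H k p.1 p.2 ω, G k p.1 p.2 ω)) := fun k =>
    funext fun ω => position_eq_cellsPosition Θ H G σ k ω
  have hind : iIndepFun (position Θ H G σ) P := by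
    rw [funext hfun]
    exact h.indep.comp (fun _ => cellsPosition x) fun _ => measurable_cellsPosition x
  have hlaw : ∀ k, P.map (position Θ H G σ k) = (nuLaw (1 - (Fintype.card F : ℝ)⁻¹)).map
      fun z : ℝ => ((z + Real.logb 2 (hammingNorm x / m) : ℝ) : EReal) := fun k => by
    rw [hfun, ← AEMeasurable.map_map_of_aemeasurable (measurable_cellsPosition x).aemeasurable
      (h.hasLaw k).aemeasurable, (h.hasLaw k).map_eq,
      map_cellsPosition_subsketchLaw (by omega) hx]
  have hL := memLp_twoPowMean hr hr1 hW hind hlaw hm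
  have h1 := integral_twoPowMean_pow hr hr1 hW hind hlaw 1 (by omega)
  have h2 := integral_twoPowMean_pow hr hr1 hW hind hlaw 2 (by omega)
  rw [Real.rpow_logb two_pos (by norm_num) (by positivity)] at h1 h2
  simp only [pow_one, Nat.cast_one] at h1
  rw [Nat.cast_ofNat] at h2
  have hp := phi_pos hr hr1 (t := 1 / (m : ℝ)) (by positivity)
    ((div_lt_one (by linarith)).2 (by linarith))
  set r := 1 - (Fintype.card F : ℝ)⁻¹ with hrdef
  have hE : (fun ω => estimator (Fintype.card F) fun k => position Θ H G σ k ω) =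
      fun ω => (phi (1 / (m : ℝ)) r ^ (-(m : ℤ)) * m) *
        twoPowMean fun k => position Θ H G σ k ω := rfl
  have hL' := hL.const_mul (phi (1 / (m : ℝ)) r ^ (-(m : ℤ)) * m)
  have hmean : ∫ ω, estimator (Fintype.card F) (fun k => position Θ H G σ k ω) ∂P =
      hammingNorm x := by
    rw [hE, integral_const_mul, h1, zpow_neg, zpow_natCast]
    field_simp
  refine ⟨hL', hmean, ?_⟩
  rw [variance_eq_sub (X := fun ω => estimator (Fintype.card F) fun k => position Θ H G σ k ω) hL',
    hmean]
  simp only [Pi.pow_apply, hE, mul_pow _ (twoPowMean _)]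
  rw [integral_const_mul, h2, zpow_neg, zpow_neg, zpow_mul, zpow_natCast, zpow_natCast,
    zpow_ofNat]
  field_simp
  ring

end Estimator

end FPCSA

open FPCSA in
theorem theorem3 {F : Type*} [Field F] [Fintype F] [DecidableEq F] [MeasurableSpace F]
    [MeasurableSingletonClass F] :
    IsProbabilityMeasure (nuLaw (1 - (Fintype.card F : ℝ)⁻¹)) ∧
    MemLp (fun z : ℝ => z) 2 (nuLaw (1 - (Fintype.card F : ℝ)⁻¹)) ∧
    (∀ t : ℝ, 0 < t → t < 1 →
      Integrable (fun z : ℝ => (2 : ℝ) ^ (t * z) * nu z (1 - (Fintype.card F : ℝ)⁻¹))) ∧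
    (∃ δE δV : ℕ → ℝ,
      δE =O[atTop] (fun m : ℕ => 1 / (m : ℝ)) ∧
      δV =O[atTop] (fun m : ℕ => 1 / (m : ℝ)) ∧
      ∀ (m : ℕ), 3 ≤ m →
        phi (1 / (m : ℝ)) (1 - (Fintype.card F : ℝ)⁻¹) ^ (-(m : ℤ)) =
          (2 : ℝ) ^ (-psiE (Fintype.card F)) + δE m ∧
        ∀ (n : ℕ) {Ω : Type*} [MeasurableSpace Ω] (P : Measure Ω) [IsProbabilityMeasure P]
          (Θ : Fin m → Ω → ℝ) (H G : Fin m → Fin n → ℤ → Ω → F),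
          IsSketchRandomness P Θ H G →
          ∀ σ : List (Fin n × F),
            MemLp (fun ω => estimator (Fintype.card F) fun k => position Θ H G σ k ω) 2 P ∧
            ∫ ω, estimator (Fintype.card F) (fun k => position Θ H G σ k ω) ∂P =
              hammingNorm (streamState σ) ∧
            variance (fun ω => estimator (Fintype.card F) fun k => position Θ H G σ k ω) P =
              (phi (1 / (m : ℝ)) (1 - (Fintype.card F : ℝ)⁻¹) ^ (-(2 * (m : ℤ))) *
                phi (2 / (m : ℝ)) (1 - (Fintype.card F : ℝ)⁻¹) ^ m - 1) *
                (hammingNorm (streamState σ) : ℝ) ^ 2 ∧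
            (∀ ω, estimator (Fintype.card F) (fun k => position Θ H G σ k ω) =
              ((2 : ℝ) ^ (-psiE (Fintype.card F)) + δE m) * (m : ℝ) *
                twoPowMean fun k => position Θ H G σ k ω) ∧
            variance (fun ω => estimator (Fintype.card F) fun k => position Θ H G σ k ω) P =
              (hammingNorm (streamState σ) : ℝ) ^ 2 * (m : ℝ)⁻¹ *
                (Real.log 2 ^ 2 * psiV (Fintype.card F) + δV m)) ∧
    Real.sqrt (Real.log 2 ^ 2 * psiV (Fintype.card F)) < Real.sqrt 79 := by
  have hr := one_half_le_one_sub_inv_card F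
  have hr1 := one_sub_inv_card_le_one F
  have hr0 : 0 ≤ 1 - (Fintype.card F : ℝ)⁻¹ := by linarith
  have hprob := isProbabilityMeasure_nuLaw hr hr1
  have hint := zero_mem_interior_integrableExpSet hr hr1
  refine ⟨hprob, memLp_of_mem_interior_integrableExpSet hint 2,
    fun t h0 h1 => integrable_two_rpow_mul_nu hr hr1 h0.le h1, ?_, ?_⟩
  · refine ⟨fun m => phi (1 / (m : ℝ)) (1 - (Fintype.card F : ℝ)⁻¹) ^ (-(m : ℤ)) -
        (2 : ℝ) ^ (-psiE (Fintype.card F)),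
      fun m => (m : ℝ) * (phi (1 / (m : ℝ)) (1 - (Fintype.card F : ℝ)⁻¹) ^ (-(2 * (m : ℤ))) *
        phi (2 / (m : ℝ)) (1 - (Fintype.card F : ℝ)⁻¹) ^ m - 1) -
          Real.log 2 ^ 2 * psiV (Fintype.card F), ?_, ?_, fun m hm => ⟨by ring, ?_⟩⟩
    · refine (mgf_zpow_neg_isBigO hint (Real.log 2)).congr_left fun m => ?_
      rw [phi_eq_mgf hr0 hr1, Real.rpow_def_of_pos two_pos, psiE, mul_neg, one_div_mul_eq_div]
    · refine (mgf_zpow_neg_mul_pow_isBigO hint (Real.log 2)).congr_left fun m => ?_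
      rw [phi_eq_mgf hr0 hr1, phi_eq_mgf hr0 hr1, psiV, one_div_mul_eq_div, div_mul_eq_mul_div]
    · intro n Ω _ P _ Θ H G h σ
      obtain ⟨h1, h2, h3⟩ := estimator_moments hm h σ
      have hm0 : (m : ℝ) ≠ 0 := by
        have : m ≠ 0 := by omega
        exact_mod_cast this
      refine ⟨h1, h2, h3, fun ω => ?_, ?_⟩
      · rw [add_sub_cancel]; rfl
      · rw [h3, add_sub_cancel]
        field_simp
  · have hv := variance_nuLaw_le hr hr1
    refine Real.sqrt_lt_sqrt (mul_nonneg (sq_nonneg _) (variance_nonneg _ _)) ?_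
    have hl : Real.log 2 ^ 2 ≤ 0.6932 ^ 2 := by
      have := Real.log_two_lt_d9
      have := Real.log_pos one_lt_two
      gcongr
      linarith
    calc Real.log 2 ^ 2 * psiV (Fintype.card F) ≤ 0.6932 ^ 2 * (1.4 * 108) := by
          refine mul_le_mul hl hv (variance_nonneg _ _) (by norm_num)
      _ < 79 := by norm_num
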